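/- All graphs are finite, simple and undirected. A \emph{decoder} is a directed graph $D=(\Sigma,A)$ (loops allowed) on a finite alphabet $\Sigma$. A \emph{letter realisation} over $D$ of an $n$-vertex graph $G=(V,E)$ is a pair $(\ell,c)$ consisting of a map $\ell:V\to\Sigma$ and a bijection $c:V\to\{1,\dots,n\}$ such that $x,y\in V$ are adjacent in $G$ if and only if either $(\ell(x),\ell(y))\in A$ and $c(x)<c(y)$, or $(\ell(y),\ell(x))\in A$ and $c(y)<c(x)$. It is a \emph{$k$-letter realisation} if $|\Sigma|=k$; its word is $w(\ell,c)=w_1\cdots w_n$ with $w_i=\ell(c^{-1}(i))$. The \emph{lettericity} of $G$ is the least $k$ for which $G$ has a $k$-letter realisation. A \emph{critical $k$-letter graph} is a graph of lettericity $k$ all of whose proper induced subgraphs have lettericity less than $k$. A \emph{factor} of a word is a contiguous subword. For natural numbers $k,t$ let $f_k(t)\in\mathbb{N}\cup\{\infty\}$ be the supremum of the lengths of all factors that use at most $t$ distinct letters, taken over the words $w(\ell,c)$ of all $k$-letter realisations $(\ell,c)$ of all critical $k$-letter graphs. Then: 1. $f_k(1)\le 3$ for every natural number $k$; 2. $f_k(t)<(2^{t-1}+1)\,(k-1)^t\,t\,\bigl(f_k(t-1)+1\bigr)$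 for all natural numbers $k,t$ with $2\le t\le k$ (so, together with (1), $f_k(t)$ is finite for $1\le t\le k$); 3. $f_k(k)=2^{O(k^2\log k)}$, that is, there is a constant $C$ such that $f_k(k)$ is finite and $f_k(k)\le 2^{Ck^2\log k}$ for every $k\ge 2$. -/

import Mathlib

namespace LetterGraph

/-- `(ℓ, c)` is a letter realisation of the graph `G` over the decoder `D`.  A decoder is a directed
graph on the alphabet `S` (loops allowed); `c` is the ordering of the `n` vertices of `G`. -/
def IsRealisation {V S : Type*} {n : ℕ} (G : SimpleGraph V) (D : Digraph S)
    (ℓ : V → S) (c : V ≃ Fin n) : Prop :=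
  ∀ x y : V, G.Adj x y ↔
    (D.Adj (ℓ x) (ℓ y) ∧ c x < c y) ∨ (D.Adj (ℓ y) (ℓ x) ∧ c y < c x)

/-- `G` admits a letter realisation over some decoder whose alphabet has exactly `k` letters. -/
def IsLetterGraph {V : Type*} (k : ℕ) (G : SimpleGraph V) : Prop :=
  ∃ (S : Type) (_ : Finite S) (D : Digraph S) (n : ℕ) (ℓ : V → S) (c : V ≃ Fin n),
    Nat.card S = k ∧ IsRealisation G D ℓ c

/-- The minimum `k` such that `G` is a `k`-letter graph. -/
noncomputable def lettericity {V : Type*} (G : SimpleGraph V) : ℕ :=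
  sInf {k : ℕ | IsLetterGraph k G}

/-- Every finite graph is a `k`-letter graph for some `k`, so the minimum above exists. -/
theorem exists_isLetterGraph {V : Type*} [Finite V] (G : SimpleGraph V) :
    ∃ k, IsLetterGraph k G := by
  obtain ⟨n, ⟨c⟩⟩ := Finite.exists_equiv_fin V
  refine ⟨n, Fin n, inferInstance, ⟨fun i j => G.Adj (c.symm i) (c.symm j)⟩, n, c, c, by simp, ?_⟩
  intro x y
  simp only [Equiv.symm_apply_apply]
  constructor
  · intro h
    rcases lt_trichotomy (c x) (c y) with h1 | h1 | h1
    · exact Or.inl ⟨h, h1⟩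
    · exact absurd (c.injective h1) h.ne
    · exact Or.inr ⟨h.symm, h1⟩
  · rintro (⟨h, -⟩ | ⟨h, -⟩)
    · exact h
    · exact h.symm

/-- `G` has lettericity `k`, and each proper induced subgraph of `G` has smaller lettericity. -/
def IsCritical {V : Type*} (k : ℕ) (G : SimpleGraph V) : Prop :=
  lettericity G = k ∧ ∀ X : Set V, X ≠ Set.univ → lettericity (G.induce X) < lettericity G

/-- The word `w(ℓ, c)`: the letters of the vertices of `G`, read in the order `c`. -/
def word {V S : Type*} {n : ℕ} (ℓ : V → S) (c : V ≃ Fin n) : List S :=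
  List.ofFn fun i => ℓ (c.symm i)

/-- `f_k(t)`: the supremum, in `ℕ ∪ {∞}`, of the lengths of the factors `u`, with at most `t`
distinct letters, of the words of the `k`-letter realisations of critical `k`-letter graphs. -/
noncomputable def maxFactor (k t : ℕ) : ℕ∞ :=
  sSup {m : ℕ∞ | ∃ (V : Type) (G : SimpleGraph V) (S : Type) (_ : Finite S) (D : Digraph S)
    (n : ℕ) (ℓ : V → S) (c : V ≃ Fin n) (u : List S),
    IsCritical k G ∧ Nat.card S = k ∧ IsRealisation G D ℓ c ∧
    u <:+: word ℓ c ∧ {a : S | a ∈ u}.ncard ≤ t ∧ m = (u.length : ℕ∞)}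

end LetterGraph

namespace LetterGraph

/-! ### Realisations and lettericity -/

section Realisation

variable {V S : Type*} {n : ℕ} {G : SimpleGraph V} {D : Digraph S} {ℓ : V → S} {c : V ≃ Fin n}

/-! If a factor is too long, part of it can be deleted, the remaining graph realised with fewer than
`k` letters by criticality, and the whole factor put back without a new letter: a contradiction. The
factor is an interval `U` of the order, so a vertex outside `U` sees a vertex of `U` only through
its letter.

For one letter, three survivors suffice: all of `U` is placed at the middle one
(`isLetterGraph_of_middle`).

For `t` letters, cut the factor into blocks just too long to have fewer than `t` letters, so that
each contains every letter. Keep one vertex per letter in all blocks but one. By pigeonhole, `t + 1`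
of the blocks receive the same pattern of new letters. Join two letters if the decoder is not
symmetric on them. Adjacency then reveals relative order, so on these blocks the new realisation
copies or reverses the old order of the two letters. Each step along a path costs one index, and a
path of letters has fewer than `t` edges. Hence the spans of the letters in a component of this
graph meet pairwise, and therefore have a common point (`exists_common_point`). All vertices of `U`
with letters in that component are inserted there, in the old order or its reverse; between
components order is irrelevant (`isLetterGraph_of_reinsert`). -/

theorem IsRealisation.adj_iff_of_lt (hr : IsRealisation G D ℓ c) {x y : V} (h : c x < c y) :
    G.Adj x y ↔ D.Adj (ℓ x) (ℓ y) := by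
  rw [hr x y]
  simp [h, h.not_gt]

/-- Vertices with the same letter are twins with respect to a vertex that does not separate
them in the order. -/
theorem IsRealisation.adj_iff_adj (hr : IsRealisation G D ℓ c) {y y' z : V} (hℓ : ℓ y = ℓ y')
    (h₁ : c z < c y ↔ c z < c y') (h₂ : c y < c z ↔ c y' < c z) : G.Adj z y ↔ G.Adj z y' := by
  rw [hr z y, hr z y', hℓ, h₁, h₂]

/-- A graph whose vertices are lettered, and ordered by an injective key, is a letter graph. -/
theorem isLetterGraph_of_key {V : Type*} [Finite V] {G : SimpleGraph V} {S : Type} [Finite S]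
    (D : Digraph S) (ℓ : V → S) {L : Type*} [LinearOrder L] (key : V → L)
    (hkey : Function.Injective key)
    (h : ∀ x y, key x < key y → (G.Adj x y ↔ D.Adj (ℓ x) (ℓ y))) :
    IsLetterGraph (Nat.card S) G := by
  have := Fintype.ofFinite V
  let : LinearOrder V := LinearOrder.lift' key hkey
  have hlt : ∀ x y : V, x < y ↔ key x < key y := fun _ _ => Iff.rfl
  let c := Fintype.orderIsoFinOfCardEq V rfl
  refine ⟨S, inferInstance, D, _, ℓ, c.symm.toEquiv, rfl, fun x y => ?_⟩
  have hc (x y : V) : c.symm.toEquiv x < c.symm.toEquiv y ↔ key x < key y := by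
    rw [← hlt]
    exact c.symm.lt_iff_lt
  rw [hc, hc]
  rcases lt_trichotomy (key x) (key y) with h1 | h1 | h1
  · simp [h1, h1.not_gt, h x y h1]
  · simp [hkey h1]
  · simp [h1, h1.not_gt, G.adj_comm x y, h y x h1]

theorem lettericity_le {V : Type*} {G : SimpleGraph V} {k : ℕ} (h : IsLetterGraph k G) :
    lettericity G ≤ k := Nat.sInf_le h

theorem isLetterGraph_lettericity {V : Type*} [Finite V] (G : SimpleGraph V) :
    IsLetterGraph (lettericity G) G := Nat.sInf_mem (exists_isLetterGraph G)

end Realisation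

/-! ### Putting an interval back into a smaller realisation -/

section Reinsert

variable {V S : Type*} {S' : Type} {n m : ℕ} {G : SimpleGraph V} {D : Digraph S} {ℓ : V → S}
  {c : V ≃ Fin n} {Y : Set V} {D' : Digraph S'} {ℓ' : Y → S'} {c' : Y ≃ Fin m}

/-- `U` is an interval of the order `c`: no vertex outside `U` separates two vertices of `U`. -/
def IsInterval (c : V ≃ Fin n) (U : Set V) : Prop :=
  ∀ z ∉ U, ∀ y ∈ U, ∀ y' ∈ U, c z < c y → c z < c y'

/-- An outside vertex lies on one side of the whole interval, so only letters matter. -/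
theorem IsInterval.adj_iff_adj (hr : IsRealisation G D ℓ c) {U : Set V} (hU : IsInterval c U)
    {z y y' : V} (hz : z ∉ U) (hy : y ∈ U) (hy' : y' ∈ U) (hℓ : ℓ y = ℓ y') :
    G.Adj z y ↔ G.Adj z y' := by
  have h1 : c z < c y ↔ c z < c y' := ⟨hU z hz y hy y' hy', hU z hz y' hy' y hy⟩
  have hne : ∀ w ∈ U, c w ≠ c z := fun w hw h => hz (c.injective h ▸ hw)
  refine hr.adj_iff_adj hℓ h1 ?_
  rw [← not_iff_not, not_lt, not_lt, (hne y hy).symm.le_iff_lt, (hne y' hy').symm.le_iff_lt, h1]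

/-- Four consecutive vertices with the same letter, one of which is missing in a realisation of an
induced subgraph, can all be put back without a new letter. -/
theorem isLetterGraph_of_middle [Finite V] [Finite S'] (hr : IsRealisation G D ℓ c) {U : Set V}
    (hU : IsInterval c U) {a : S} (ha : ∀ y ∈ U, ℓ y = a) (hY : Uᶜ ⊆ Y)
    (hr' : IsRealisation (G.induce Y) D' ℓ' c') {u v w : Y} (hu : u.1 ∈ U) (hv : v.1 ∈ U)
    (hw : w.1 ∈ U) (huv : c' u < c' v) (hvw : c' v < c' w) :
    IsLetterGraph (Nat.card S') G := by
  classical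
  have hUU : ∀ x ∈ U, ∀ y ∈ U, x ≠ y → (G.Adj x y ↔ D.Adj a a) := by
    intro x hx y hy hxy
    rw [hr x y, ha x hx, ha y hy]
    rcases lt_or_gt_of_ne (c.injective.ne hxy) with h | h <;> simp [h, h.not_gt]
  have htw : ∀ z : Y, z.1 ∉ U → ∀ y ∈ U, ∀ y' ∈ U, (G.Adj z y ↔ G.Adj z y') :=
    fun z hz y hy y' hy' => hU.adj_iff_adj hr hz hy hy' ((ha y hy).trans (ha y' hy').symm)
  have hne : ∀ x y : Y, c' x < c' y → x.1 ≠ y.1 := fun x y h e => by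
    rw [Subtype.ext e] at h
    exact lt_irrefl _ h
  have hlt : ∀ x y : Y, c' x < c' y → (G.Adj x y ↔ D'.Adj (ℓ' x) (ℓ' y)) :=
    fun x y h => hr'.adj_iff_of_lt h
  -- An outside vertex sharing the letter of `v` forces the loop to be right already: it is a twin
  -- test against `w` if it precedes `v`, against `u` if it follows. So correcting the loop in `D''`
  -- changes no adjacency outside `U`.
  have hloop : ∀ z : Y, z.1 ∉ U → ℓ' z = ℓ' v → (D'.Adj (ℓ' v) (ℓ' v) ↔ D.Adj a a) := by
    intro z hz hzv
    rcases lt_trichotomy (c' z) (c' v) with h | h | h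
    · have h1 := hlt z v h
      rw [hzv] at h1
      have h2 := hlt z w (h.trans hvw)
      rw [hzv] at h2
      rw [← h1, htw z hz _ hv _ hw, h2, ← hlt v w hvw, hUU _ hv _ hw (hne _ _ hvw)]
    · exact absurd (c'.injective h ▸ hv) hz
    · have h1 := hlt v z h
      rw [hzv] at h1
      have h2 := hlt u z (huv.trans h)
      rw [hzv] at h2
      rw [← h1, G.adj_comm, htw z hz _ hv _ hu, G.adj_comm, h2, ← hlt u v huv,
        hUU _ hu _ hv (hne _ _ huv)]
  let D'' : Digraph S' := ⟨fun x y => if x = ℓ' v ∧ y = ℓ' v then D.Adj a a else D'.Adj x y⟩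
  have hD : ∀ x y, D''.Adj x y = if x = ℓ' v ∧ y = ℓ' v then D.Adj a a else D'.Adj x y :=
    fun _ _ => rfl
  have hD' : ∀ z : Y, z.1 ∉ U → ∀ y : S', (D''.Adj (ℓ' z) y ↔ D'.Adj (ℓ' z) y) ∧
      (D''.Adj y (ℓ' z) ↔ D'.Adj y (ℓ' z)) := by
    intro z hz y
    rw [hD, hD]
    constructor <;> split_ifs with h
    · rw [h.1, h.2, hloop z hz h.1]
    · rfl
    · rw [h.1, h.2, hloop z hz h.2]
    · rfl
  -- Every vertex of `U`, surviving or not, moves to the place of `v`.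
  let key : V → Fin m ×ₗ Fin n := fun x =>
    if h : x ∈ U then toLex (c' v, c x) else toLex (c' ⟨x, hY h⟩, c x)
  have hkU : ∀ x ∈ U, key x = toLex (c' v, c x) := fun x hx => dif_pos hx
  have hkY : ∀ x (hx : x ∉ U), key x = toLex (c' ⟨x, hY hx⟩, c x) := fun x hx => dif_neg hx
  let lab : V → S' := fun x => if h : x ∈ U then ℓ' v else ℓ' ⟨x, hY h⟩
  have hlU : ∀ x ∈ U, lab x = ℓ' v := fun x hx => dif_pos hx
  have hlY : ∀ x (hx : x ∉ U), lab x = ℓ' ⟨x, hY hx⟩ := fun x hx => dif_neg hx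
  have hvne : ∀ x (hx : x ∉ U), c' ⟨x, hY hx⟩ ≠ c' v := fun x hx h => by
    have := c'.injective h
    exact hx (by rw [← this] at hv; exact hv)
  refine isLetterGraph_of_key D'' lab key (fun x y hxy => ?_) fun x y hxy => ?_
  · have h2 : ∀ x, (ofLex (key x)).2 = c x := fun x => by
      by_cases hx : x ∈ U
      · rw [hkU x hx]; rfl
      · rw [hkY x hx]; rfl
    exact c.injective (by rw [← h2, ← h2, hxy])
  · by_cases hx : x ∈ U <;> by_cases hy : y ∈ U
    · rw [hkU x hx, hkU y hy, Prod.Lex.toLex_lt_toLex] at hxy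
      have : x ≠ y := by rintro rfl; simp at hxy
      rw [hUU x hx y hy this, hlU x hx, hlU y hy, hD]
      simp
    · rw [hkU x hx, hkY y hy, Prod.Lex.toLex_lt_toLex] at hxy
      rw [hlU x hx, hlY y hy, (hD' ⟨y, hY hy⟩ hy _).2, ← hlt v _
        (hxy.resolve_right fun h => hvne y hy h.1.symm), G.adj_comm, G.adj_comm v.1]
      exact htw ⟨y, hY hy⟩ hy x hx v hv
    · rw [hkY x hx, hkU y hy, Prod.Lex.toLex_lt_toLex] at hxy
      rw [hlY x hx, hlU y hy, (hD' ⟨x, hY hx⟩ hx _).1, ← hlt _ v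
        (hxy.resolve_right fun h => hvne x hx h.1)]
      exact htw ⟨x, hY hx⟩ hx y hy v hv
    · rw [hkY x hx, hkY y hy, Prod.Lex.toLex_lt_toLex] at hxy
      have : c' ⟨x, hY hx⟩ < c' ⟨y, hY hy⟩ := by
        refine hxy.resolve_right fun h => ?_
        have h1 : x = y := congrArg Subtype.val (c'.injective h.1)
        exact absurd h.2 (by simp [h1])
      rw [hlY x hx, hlY y hy, (hD' ⟨y, hY hy⟩ hy _).2, ← hlt _ _ this]

/-- All vertices of an interval `U` can be reinserted into a realisation of an induced subgraph
that contains, for each letter of `U`, two suitable reference vertices `first` and `last`. -/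
theorem isLetterGraph_of_reinsert [Finite V] [Finite S'] (hr : IsRealisation G D ℓ c) {U : Set V}
    (hU : IsInterval c U) {T : Set S} (hT : ∀ y ∈ U, ℓ y ∈ T) (hY : Uᶜ ⊆ Y)
    (hr' : IsRealisation (G.induce Y) D' ℓ' c') (φ : S → S') (first last : S → Y) (p : S → Fin m)
    (hfirst : ∀ b ∈ T, (first b).1 ∈ U ∧ ℓ (first b) = b ∧ ℓ' (first b) = φ b)
    (hlast : ∀ b ∈ T, (last b).1 ∈ U ∧ ℓ (last b) = b ∧ ℓ' (last b) = φ b)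
    (hfl : ∀ a ∈ T, ∀ b ∈ T, c (first a) < c (last b))
    (hlo : ∀ b ∈ T, min (c' (first b)) (c' (last b)) ≤ p b)
    (hhi : ∀ b ∈ T, p b < max (c' (first b)) (c' (last b)))
    (hp : ∀ b ∈ T, ∀ z : Y, z.1 ∉ U → c' z ≠ p b)
    (hsymm : ∀ a ∈ T, ∀ b ∈ T, p a ≠ p b → (D.Adj a b ↔ D.Adj b a))
    (hs : ∀ a ∈ T, ∀ b ∈ T, p a = p b →
      (c' (first a) < c' (last a) ↔ c' (first b) < c' (last b))) :
    IsLetterGraph (Nat.card S') G := by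
  classical
  have hlt : ∀ x y : Y, c' x < c' y → (G.Adj x y ↔ D'.Adj (ℓ' x) (ℓ' y)) :=
    fun x y h => hr'.adj_iff_of_lt h
  -- reference vertices on either side of `p b`
  have hleft : ∀ b ∈ T, ∃ x : Y, x.1 ∈ U ∧ ℓ x = b ∧ ℓ' x = φ b ∧ c' x ≤ p b ∧
      x = if c' (first b) < c' (last b) then first b else last b := by
    intro b hb
    split_ifs with h
    · exact ⟨first b, (hfirst b hb).1, (hfirst b hb).2.1, (hfirst b hb).2.2,
        by simpa [h.le] using hlo b hb, rfl⟩
    · exact ⟨last b, (hlast b hb).1, (hlast b hb).2.1, (hlast b hb).2.2,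
        by simpa [not_lt.1 h] using hlo b hb, rfl⟩
  have hright : ∀ b ∈ T, ∃ x : Y, x.1 ∈ U ∧ ℓ x = b ∧ ℓ' x = φ b ∧ p b < c' x ∧
      x = if c' (first b) < c' (last b) then last b else first b := by
    intro b hb
    split_ifs with h
    · exact ⟨last b, (hlast b hb).1, (hlast b hb).2.1, (hlast b hb).2.2,
        by simpa [h.le] using hhi b hb, rfl⟩
    · exact ⟨first b, (hfirst b hb).1, (hfirst b hb).2.1, (hfirst b hb).2.2,
        by simpa [not_lt.1 h] using hhi b hb, rfl⟩
  -- The new decoder is read off the left reference vertex of `a` and the right one of `b`, which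
  -- are in this order in `c'`. If `p a = p b`, the common orientation and `hfl` give their order in
  -- `c`; otherwise that order is irrelevant.
  have hpp : ∀ a ∈ T, ∀ b ∈ T, p a ≤ p b → (D'.Adj (φ a) (φ b) ↔
      if p a = p b ∧ ¬ c' (first a) < c' (last a) then D.Adj b a else D.Adj a b) := by
    intro a ha b hb hab
    obtain ⟨x, hxU, hxa, hxφ, hxp, hx⟩ := hleft a ha
    obtain ⟨y, hyU, hyb, hyφ, hyp, hy⟩ := hright b hb
    rw [← hxφ, ← hyφ, ← hlt x y (hxp.trans_lt (hab.trans_lt hyp))]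
    by_cases hpab : p a = p b
    · by_cases h : c' (first a) < c' (last a)
      · rw [if_pos h] at hx
        rw [if_pos ((hs a ha b hb hpab).1 h)] at hy
        have := hr.adj_iff_of_lt (hfl a ha b hb)
        rw [← hx, ← hy, hxa, hyb] at this
        simp [h, this]
      · rw [if_neg h] at hx
        rw [if_neg (fun h' => h ((hs a ha b hb hpab).2 h'))] at hy
        have := hr.adj_iff_of_lt (hfl b hb a ha)
        rw [← hx, ← hy, hxa, hyb] at this
        rw [G.adj_comm, this, if_pos ⟨hpab, h⟩]
    · have hsy := hsymm a ha b hb hpab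
      have hxy : x ≠ y := fun h => absurd (hxp.trans_lt (hab.trans_lt hyp)) (by simp [h])
      rw [if_neg (fun h => hpab h.1), hr x.1 y.1, hxa, hyb, ← hsy]
      rcases lt_or_gt_of_ne (c.injective.ne (Subtype.coe_injective.ne hxy)) with h | h <;>
        simp [h, h.not_gt]
  -- The sign reverses the old order at points of reversed orientation. The 0 in `key` for outside
  -- vertices never breaks a tie, since they never sit at a point `p b`.
  let pos : V → ℤ := fun x => if c' (first (ℓ x)) < c' (last (ℓ x)) then (c x : ℤ) else -(c x : ℤ)
  let key : V → Fin m ×ₗ ℤ := fun x =>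
    if h : x ∈ U then toLex (p (ℓ x), pos x) else toLex (c' ⟨x, hY h⟩, 0)
  have hkU : ∀ x ∈ U, key x = toLex (p (ℓ x), pos x) := fun x hx => dif_pos hx
  have hkY : ∀ x (hx : x ∉ U), key x = toLex (c' ⟨x, hY hx⟩, 0) := fun x hx => dif_neg hx
  let lab : V → S' := fun x => if h : x ∈ U then φ (ℓ x) else ℓ' ⟨x, hY h⟩
  have hlU : ∀ x ∈ U, lab x = φ (ℓ x) := fun x hx => dif_pos hx
  have hlY : ∀ x (hx : x ∉ U), lab x = ℓ' ⟨x, hY hx⟩ := fun x hx => dif_neg hx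
  refine isLetterGraph_of_key D' lab key (fun x y hxy => ?_) fun x y hxy => ?_
  · by_cases hx : x ∈ U <;> by_cases hy : y ∈ U
    · rw [hkU x hx, hkU y hy, toLex_inj, Prod.mk.injEq] at hxy
      have h1 := hs _ (hT x hx) _ (hT y hy) hxy.1
      have h2 := hxy.2
      simp only [pos] at h2
      apply c.injective
      split_ifs at h2 with h3 h4 h4
      · omega
      · exact absurd (h1.1 h3) h4
      · exact absurd (h1.2 h4) h3
      · omega
    · rw [hkU x hx, hkY y hy, toLex_inj, Prod.mk.injEq] at hxy
      exact absurd hxy.1.symm (hp _ (hT x hx) _ hy)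
    · rw [hkY x hx, hkU y hy, toLex_inj, Prod.mk.injEq] at hxy
      exact absurd hxy.1 (hp _ (hT y hy) _ hx)
    · rw [hkY x hx, hkY y hy, toLex_inj, Prod.mk.injEq] at hxy
      exact congrArg Subtype.val (c'.injective hxy.1)
  · by_cases hx : x ∈ U <;> by_cases hy : y ∈ U
    · rw [hkU x hx, hkU y hy, Prod.Lex.toLex_lt_toLex] at hxy
      have hTx := hT x hx
      have hTy := hT y hy
      rw [hlU x hx, hlU y hy]
      rcases hxy with h | ⟨h, h'⟩
      · rw [hpp _ hTx _ hTy h.le, if_neg (fun h' => h.ne h'.1), hr x y,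
          ← hsymm _ hTx _ hTy h.ne]
        have hxy : x ≠ y := by rintro rfl; exact lt_irrefl _ h
        rcases lt_or_gt_of_ne (c.injective.ne hxy) with h | h <;> simp [h, h.not_gt]
      · rw [hpp _ hTx _ hTy h.le]
        have h1 := hs _ hTx _ hTy h
        simp only [pos] at h'
        by_cases h3 : c' (first (ℓ x)) < c' (last (ℓ x))
        · rw [if_pos h3, if_pos (h1.1 h3)] at h'
          rw [if_neg (fun h => h.2 h3), hr.adj_iff_of_lt (by omega)]
        · rw [if_neg h3, if_neg (fun h4 => h3 (h1.2 h4))] at h'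
          rw [if_pos ⟨h, h3⟩, G.adj_comm, hr.adj_iff_of_lt (by omega)]
    · rw [hkU x hx, hkY y hy, Prod.Lex.toLex_lt_toLex] at hxy
      obtain ⟨w, hwU, hwa, hwφ, hwp, -⟩ := hleft _ (hT x hx)
      rw [hlU x hx, hlY y hy, ← hwφ, ← hlt w _ (hwp.trans_lt
        (hxy.resolve_right fun h => hp _ (hT x hx) ⟨y, hY hy⟩ hy h.1.symm)), G.adj_comm,
        G.adj_comm w.1]
      exact hU.adj_iff_adj hr hy hx hwU hwa.symm
    · rw [hkY x hx, hkU y hy, Prod.Lex.toLex_lt_toLex] at hxy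
      obtain ⟨w, hwU, hwa, hwφ, hwp, -⟩ := hright _ (hT y hy)
      rw [hlY x hx, hlU y hy, ← hwφ, ← hlt _ w
        ((hxy.resolve_right fun h => hp _ (hT y hy) ⟨x, hY hx⟩ hx h.1).trans hwp)]
      exact hU.adj_iff_adj hr hx hy hwU hwa.symm
    · rw [hkY x hx, hkY y hy, Prod.Lex.toLex_lt_toLex] at hxy
      rw [hlY x hx, hlY y hy, ← hlt _ _ (hxy.resolve_right fun h => lt_irrefl _ h.2)]

end Reinsert

end LetterGraph

namespace LetterGraph

/-! ### Common orientation and common points of components -/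

section Orientation

variable {T : Type*} [Finite T] {t m n : ℕ} {R : SimpleGraph T} {C : T → Fin (t + 1) → Fin n}
  {Q : T → Fin (t + 1) → Fin m}

/-- Sequences `Q a`, `a : T`, such that adjacent ones are ordered consistently with `C`, or
consistently with the reverse of `C`, have a common orientation and a common point on each
connected component. -/
theorem exists_common_point (ht : Nat.card T ≤ t) (ht' : 2 ≤ t)
    (hQ : ∀ a b i j, Q a i = Q b j → a = b ∧ i = j)
    (hC : ∀ a b i j, i < j → C a i < C b j)
    (hR : ∀ a b, R.Adj a b → (∀ i j, Q a i < Q b j ↔ C a i < C b j) ∨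
      (∀ i j, Q a i < Q b j ↔ C b j < C a i)) :
    ∃ p : T → Fin m,
      (∀ b, min (Q b 0) (Q b (Fin.last t)) ≤ p b ∧ p b < max (Q b 0) (Q b (Fin.last t))) ∧
      (∀ b, ∃ a i, p b = Q a i) ∧ (∀ a b, R.Adj a b → p a = p b) ∧
      (∀ a b, p a = p b → (Q a 0 < Q a (Fin.last t) ↔ Q b 0 < Q b (Fin.last t))) := by
  classical
  have := Fintype.ofFinite T
  have h01 : (0 : Fin (t + 1)) < ⟨1, by omega⟩ := by simp [Fin.lt_def]
  have h1t : (⟨1, by omega⟩ : Fin (t + 1)) < Fin.last t := by simp [Fin.lt_def]; omega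
  have h0t := h01.trans h1t
  have hgt : ∀ a b i j, Q a i ≠ Q b j → (¬ Q a i < Q b j ↔ Q b j < Q a i) := fun a b i j h => by
    rw [not_lt, h.symm.le_iff_lt]
  -- order is preserved or reversed along an edge, according to orientation
  have hpos : ∀ a b, R.Adj a b → (Q a 0 < Q a (Fin.last t) ↔ Q b 0 < Q b (Fin.last t)) ∧
      ∀ i j, i < j → if Q a 0 < Q a (Fin.last t) then Q a i < Q b j else Q b j < Q a i := by
    intro a b hab
    have hne : ∀ i j, Q a i ≠ Q b j := fun i j h => hab.ne (hQ _ _ _ _ h).1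
    rcases hR a b hab with h | h
    · have h1 : ∀ i j, i < j → Q a i < Q b j := fun i j hij => (h i j).2 (hC _ _ _ _ hij)
      have h2 : ∀ i j, i < j → Q b i < Q a j := fun i j hij => by
        rw [← hgt _ _ _ _ (hne _ _), h]
        exact (hC _ _ _ _ hij).not_gt
      -- A middle index is needed to return to `a` through `b`; this is where `2 ≤ t` enters.
      have ha := (h1 _ _ h01).trans (h2 _ _ h1t)
      have hb := (h2 _ _ h01).trans (h1 _ _ h1t)
      refine ⟨by simp only [ha, hb], fun i j hij => ?_⟩
      rw [if_pos ha]
      exact h1 i j hij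
    · have h1 : ∀ i j, i < j → Q a j < Q b i := fun i j hij => (h j i).2 (hC _ _ _ _ hij)
      have h2 : ∀ i j, i < j → Q b j < Q a i := fun i j hij => by
        rw [← hgt _ _ _ _ (hne _ _), h]
        exact (hC _ _ _ _ hij).not_gt
      have ha := (h1 _ _ h1t).trans (h2 _ _ h01)
      have hb := (h2 _ _ h1t).trans (h1 _ _ h01)
      refine ⟨by simp only [ha.not_gt, hb.not_gt], fun i j hij => ?_⟩
      rw [if_neg ha.not_gt]
      exact h2 i j hij
  have hwalk : ∀ a b (w : R.Walk a b),
      (Q a 0 < Q a (Fin.last t) ↔ Q b 0 < Q b (Fin.last t)) ∧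
      ∀ i j : Fin (t + 1), i.val + w.length ≤ j.val → 0 < w.length →
        if Q a 0 < Q a (Fin.last t) then Q a i < Q b j else Q b j < Q a i := by
    intro a b w
    induction w with
    | nil => exact ⟨Iff.rfl, fun i j _ h => by simp at h⟩
    | @cons a d b had w ih =>
      obtain ⟨h1, h2⟩ := hpos a d had
      refine ⟨h1.trans ih.1, fun i j hij _ => ?_⟩
      rw [SimpleGraph.Walk.length_cons] at hij
      rcases Nat.eq_zero_or_pos w.length with h0 | h0
      · obtain rfl := SimpleGraph.Walk.eq_of_length_eq_zero h0
        exact h2 i j (by rw [Fin.lt_def]; omega)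
      · have h3 := h2 i ⟨i + 1, by omega⟩ (by simp [Fin.lt_def])
        have h4 := ih.2 ⟨i + 1, by omega⟩ j (by simp only; omega) h0
        simp only [← h1] at h4
        split_ifs at h3 h4 ⊢
        · exact h3.trans h4
        · exact h4.trans h3
  have hreach : ∀ a b, R.Reachable a b →
      (Q a 0 < Q a (Fin.last t) ↔ Q b 0 < Q b (Fin.last t)) ∧
      if Q a 0 < Q a (Fin.last t) then Q a 0 < Q b (Fin.last t)
        else Q b (Fin.last t) < Q a 0 := by
    intro a b hab
    obtain ⟨w, hw⟩ := hab.exists_isPath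
    -- A path has fewer than `t` edges, so the indices from 0 to `t` leave room for one increment
    -- per edge.
    have hlen := hw.length_lt
    rw [← Nat.card_eq_fintype_card] at hlen
    refine ⟨(hwalk a b w).1, ?_⟩
    rcases Nat.eq_zero_or_pos w.length with h0 | h0
    · obtain rfl := SimpleGraph.Walk.eq_of_length_eq_zero h0
      split_ifs with h
      · exact h
      · exact (hgt _ _ _ _ fun h => h0t.ne (hQ _ _ _ _ h).2).1 h
    · exact (hwalk a b w).2 0 (Fin.last t) (by simp; omega) h0
  let lo : T → Fin m := fun b => min (Q b 0) (Q b (Fin.last t))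
  have hlohi : ∀ a b, R.Reachable a b → lo a < max (Q b 0) (Q b (Fin.last t)) := by
    intro a b hab
    have h1 := hreach a b hab
    have h2 := (hreach b a hab.symm).2
    simp only [← h1.1] at h2
    by_cases h : Q a 0 < Q a (Fin.last t)
    · exact (min_le_left _ _).trans_lt ((if_pos h ▸ h1.2).trans_le (le_max_right _ _))
    · exact (min_le_right _ _).trans_lt ((if_neg h ▸ h2).trans_le (le_max_left _ _))
  -- Helly's theorem on a line: by `hlohi`, the largest left end in a component lies in every span.
  -- Being a left end, it is strictly below all right ends and may equal a left one.
  have hrep : ∀ κ : R.ConnectedComponent, ∃ a, R.connectedComponentMk a = κ ∧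
      ∀ b, R.connectedComponentMk b = κ → lo b ≤ lo a := by
    intro κ
    obtain ⟨a, ha, hmax⟩ := Finset.exists_max_image
      (Finset.univ.filter fun a => R.connectedComponentMk a = κ) lo (by
        obtain ⟨a, ha⟩ := κ.exists_rep
        exact ⟨a, Finset.mem_filter.2 ⟨Finset.mem_univ a, ha⟩⟩)
    exact ⟨a, by simpa using ha, fun b hb => hmax b (by simpa using hb)⟩
  choose rep hrep hmax using hrep
  have hlo : ∀ b, ∃ i, lo b = Q b i := fun b => by
    rcases min_choice (Q b 0) (Q b (Fin.last t)) with h | h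
    · exact ⟨_, h⟩
    · exact ⟨_, h⟩
  refine ⟨fun b => lo (rep (R.connectedComponentMk b)), fun b => ⟨hmax _ b rfl, ?_⟩, fun b => ?_,
    fun a b hab => ?_, fun a b hab => ?_⟩
  · exact hlohi _ _ (SimpleGraph.ConnectedComponent.exact (hrep _))
  · obtain ⟨i, hi⟩ := hlo (rep (R.connectedComponentMk b))
    exact ⟨_, i, hi⟩
  · simp only [SimpleGraph.ConnectedComponent.sound hab.reachable]
  · obtain ⟨i, hi⟩ := hlo (rep (R.connectedComponentMk a))
    obtain ⟨j, hj⟩ := hlo (rep (R.connectedComponentMk b))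
    have h1 := (hQ _ _ _ _ (hi.symm.trans (hab.trans hj))).1
    have h2 : R.connectedComponentMk a = R.connectedComponentMk b := by
      rw [← hrep (R.connectedComponentMk a), h1, hrep]
    exact (hreach a b (SimpleGraph.ConnectedComponent.exact h2)).1

end Orientation

end LetterGraph

namespace LetterGraph

/-! ### Factors and their blocks -/

section Factor

variable {V S : Type*} {n : ℕ} {ℓ : V → S} {c : V ≃ Fin n} {u : List S}

/-- A factor of the word occupies consecutive positions. -/
theorem exists_offset (hu : u <:+: word ℓ c) :
    ∃ off, ∃ h : off + u.length ≤ n, ∀ i (hi : i < u.length),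
      u[i] = ℓ (c.symm ⟨off + i, by omega⟩) := by
  obtain ⟨s, e, h⟩ := hu
  have hlen : s.length + u.length + e.length = n := by
    simpa [word, add_assoc] using congrArg List.length h
  refine ⟨s.length, by omega, fun i hi => ?_⟩
  have h1 : (word ℓ c)[s.length + i]'(by rw [← h]; simp; omega) = u[i] := by
    simp only [← h]
    rw [List.getElem_append_left (by simp; omega), List.getElem_append_right (by omega)]
    simp
  rw [← h1]
  simp [word]

/-- If factors of length `m + 1` need `t` letters, then each block of length `m + 1` of a word `u`
with `t` letters contains every letter of `u`. -/
theorem exists_block {off t m : ℕ} (h : off + u.length ≤ n)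
    (hoff : ∀ i (hi : i < u.length), u[i] = ℓ (c.symm ⟨off + i, by omega⟩))
    (hm : ∀ v : List S, v <:+: u → {a | a ∈ v}.ncard ≤ t - 1 → v.length ≤ m)
    (ht : {a | a ∈ u}.ncard ≤ t) {j : ℕ} (hj : (j + 1) * (m + 1) ≤ u.length) {b : S}
    (hb : b ∈ u) : ∃ x : V, ℓ x = b ∧ off + j * (m + 1) ≤ c x ∧ c x < off + (j + 1) * (m + 1) := by
  have hj' : j * (m + 1) + (m + 1) ≤ u.length := by rw [← Nat.succ_mul]; exact hj
  set v := (u.drop (j * (m + 1))).take (m + 1) with hv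
  have hvl : v.length = m + 1 := by simp [hv]; omega
  have hvu : v <:+: u := (List.take_prefix _ _).isInfix.trans (List.drop_suffix _ _).isInfix
  have hcard : t ≤ {a | a ∈ v}.ncard := by
    by_contra hlt
    have := hm v hvu (by omega)
    omega
  have heq : {a | a ∈ v} = {a | a ∈ u} :=
    Set.eq_of_subset_of_ncard_le (fun a ha => hvu.subset ha) (ht.trans hcard) u.finite_toSet
  have hbv : b ∈ v := by
    have : b ∈ {a | a ∈ u} := hb
    rwa [← heq] at this
  obtain ⟨i, hi, rfl⟩ := List.getElem_of_mem hbv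
  refine ⟨c.symm ⟨off + (j * (m + 1) + i), by omega⟩, ?_, ?_, ?_⟩
  · rw [← hoff _ (by omega)]
    simp [hv]
  · rw [Equiv.apply_symm_apply]; simp only; omega
  · rw [Nat.succ_mul]; simp; omega

theorem isInterval_setOf (a b : ℕ) : IsInterval c {x | a ≤ c x ∧ (c x : ℕ) < b} := by
  intro z hz y hy y' hy' h
  simp only [Set.mem_ofPred_eq, not_and_or, Fin.lt_def] at *
  omega

end Factor

/-! ### Long factors contradict criticality -/

theorem IsCritical.exists_realisation {V : Type} [Finite V] {G : SimpleGraph V} {k : ℕ}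
    (hG : IsCritical k G) {Y : Set V} (hY : Y ≠ Set.univ) :
    ∃ (S' : Type) (_ : Finite S') (D' : Digraph S') (m : ℕ) (ℓ' : Y → S') (c' : Y ≃ Fin m),
      Nat.card S' < k ∧ IsRealisation (G.induce Y) D' ℓ' c' := by
  have h := hG.2 Y hY
  obtain ⟨S', hS', D', m, ℓ', c', hcard, hr'⟩ := isLetterGraph_lettericity (G.induce Y)
  exact ⟨S', hS', D', m, ℓ', c', by rw [hcard, ← hG.1]; exact h, hr'⟩

theorem IsCritical.not_isLetterGraph {V : Type} {G : SimpleGraph V} {k j : ℕ}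
    (hG : IsCritical k G) (hj : j < k) : ¬ IsLetterGraph j G := fun h => by
  have := lettericity_le h
  rw [hG.1] at this
  omega

/-- Delete one of four consecutive vertices with the same letter; one of the other three is the
middle one in the smaller realisation, whichever way it orders them. -/
theorem length_le_three {V S : Type} {G : SimpleGraph V} {D : Digraph S} {k n : ℕ} {ℓ : V → S}
    {c : V ≃ Fin n} {u : List S} (hG : IsCritical k G) (hr : IsRealisation G D ℓ c)
    (hu : u <:+: word ℓ c) (h1 : {a | a ∈ u}.ncard ≤ 1) : u.length ≤ 3 := by
  by_contra! hlen
  have : Finite V := Finite.of_equiv _ c.symm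
  obtain ⟨off, hle, hoff⟩ := exists_offset hu
  have hnh : ∀ i < 4, off + i < n := fun i hi => by omega
  let x : Fin 4 → V := fun i => c.symm ⟨off + i, hnh i i.2⟩
  have hcx : ∀ i, (c (x i) : ℕ) = off + i := fun i => by simp [x]
  have hx : ∀ i j, x i = x j → i = j := fun i j h => by
    have := hcx i
    rw [h, hcx j] at this
    omega
  have hlet : ∀ i (hi : i < u.length), u[i] = u[0] := fun i hi =>
    (Set.ncard_le_one_iff u.finite_toSet).1 h1 (List.getElem_mem hi) (List.getElem_mem _)
  set U : Set V := {y | off ≤ c y ∧ (c y : ℕ) < off + 4} with hU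
  have hxU : ∀ i, x i ∈ U := fun i => by simp only [hU, Set.mem_ofPred_eq, hcx]; omega
  have ha : ∀ y ∈ U, ℓ y = u[0] := by
    rintro y ⟨hy1, hy2⟩
    rw [← hlet (c y - off) (by omega), hoff]
    congr 1
    rw [Equiv.eq_symm_apply, Fin.ext_iff]
    simp only
    omega
  let Y : Set V := {x 3}ᶜ
  have hxY : ∀ i : Fin 4, i ≠ 3 → x i ∈ Y := fun i hi h => hi (hx _ _ h)
  obtain ⟨S', _, D', m, ℓ', c', hcard, hr'⟩ := hG.exists_realisation (Y := Y)
    (fun h => by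
      have : x 3 ∈ Y := h ▸ Set.mem_univ _
      exact this rfl)
  have hYU : Uᶜ ⊆ Y := fun z hz h => hz (h ▸ hxU 3)
  have key : ∀ i₁ i₂ i₃ : Fin 4, ∀ (h₁ : i₁ ≠ 3) (h₂ : i₂ ≠ 3) (h₃ : i₃ ≠ 3),
      c' ⟨x i₁, hxY _ h₁⟩ < c' ⟨x i₂, hxY _ h₂⟩ → c' ⟨x i₂, hxY _ h₂⟩ < c' ⟨x i₃, hxY _ h₃⟩ →
      False := fun i₁ i₂ i₃ h₁ h₂ h₃ h12 h23 =>
    hG.not_isLetterGraph hcard (isLetterGraph_of_middle hr (isInterval_setOf _ _) ha hYU hr'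
      (hxU i₁) (hxU i₂) (hxU i₃) h12 h23)
  have hne : ∀ i j (hi : i ≠ 3) (hj : j ≠ 3), i ≠ j →
      c' ⟨x i, hxY _ hi⟩ ≠ c' ⟨x j, hxY _ hj⟩ := fun i j hi hj hij h =>
    hij (hx _ _ (congrArg Subtype.val (c'.injective h)))
  have h0 : (0 : Fin 4) ≠ 3 := by decide
  have h1 : (1 : Fin 4) ≠ 3 := by decide
  have h2 : (2 : Fin 4) ≠ 3 := by decide
  rcases lt_or_gt_of_ne (hne 0 1 h0 h1 (by decide)) with h01 | h01 <;>
  rcases lt_or_gt_of_ne (hne 1 2 h1 h2 (by decide)) with h12 | h12 <;>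
  rcases lt_or_gt_of_ne (hne 0 2 h0 h2 (by decide)) with h02 | h02
  · exact key 0 1 2 h0 h1 h2 h01 h12
  · exact key 0 1 2 h0 h1 h2 h01 h12
  · exact key 0 2 1 h0 h2 h1 h02 h12
  · exact key 2 0 1 h2 h0 h1 h02 h01
  · exact key 1 0 2 h1 h0 h2 h01 h02
  · exact key 1 2 0 h1 h2 h0 h12 h02
  · exact key 2 1 0 h2 h1 h0 h12 h01
  · exact key 2 1 0 h2 h1 h0 h12 h01

/-- A nonconstant function of a single bit determines the bit up to negation. Here the bit is the
relative order of two vertices and the function is their adjacency. -/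
theorem iff_or_iff_not_of_ite_iff_ite {ι : Type*} {P P' : ι → Prop} [DecidablePred P]
    [DecidablePred P'] {A B A' B' : Prop} (hAB : ¬ (A ↔ B)) {i₁ i₂ : ι} (h₁ : P i₁) (h₂ : ¬ P i₂)
    (h : ∀ i, (if P i then A else B) ↔ if P' i then A' else B') :
    (∀ i, P' i ↔ P i) ∨ ∀ i, P' i ↔ ¬ P i := by
  have h3 := h i₁
  have h4 := h i₂
  rw [if_pos h₁] at h3
  rw [if_neg h₂] at h4
  have hAB' : ¬ (A' ↔ B') := fun h' => by
    simp only [h', ite_self] at h3 h4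
    exact hAB (h3.trans h4.symm)
  clear h3 h4 h₁ h₂
  by_cases hd : A' ↔ A
  · refine Or.inl fun i => ?_
    have := h i
    clear h
    split_ifs at this <;> tauto
  · refine Or.inr fun i => ?_
    have := h i
    clear h
    split_ifs at this <;> tauto

/-- An interval whose letters all occur in each of `t + 1` successive blocks, on which a
realisation of an induced subgraph is uniform, can be reinserted into that realisation. -/
theorem isLetterGraph_of_uniform_blocks {V S : Type*} {G : SimpleGraph V}
    {S' : Type} [Finite V] [Finite S'] {D : Digraph S} {n m t : ℕ} {ℓ : V → S} {c : V ≃ Fin n}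
    {Y : Set V} {D' : Digraph S'} {ℓ' : Y → S'} {c' : Y ≃ Fin m} (hr : IsRealisation G D ℓ c)
    {U : Set V} (hU : IsInterval c U) {T : Set S} [Finite T] [Nonempty T]
    (hUT : ∀ y ∈ U, ℓ y ∈ T) (hUY : Uᶜ ⊆ Y) (hr' : IsRealisation (G.induce Y) D' ℓ' c')
    (hTcard : Nat.card T ≤ t) (ht' : 2 ≤ t) (z : T → Fin (t + 1) → Y) (φ : T → S')
    (hzU : ∀ a i, (z a i).1 ∈ U) (hzℓ : ∀ a i, ℓ (z a i) = a) (hzℓ' : ∀ a i, ℓ' (z a i) = φ a)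
    (hzlt : ∀ a b i j, i < j → c (z a i) < c (z b j)) : IsLetterGraph (Nat.card S') G := by
  classical
  have hzinj : ∀ a b i j, z a i = z b j → a = b ∧ i = j := fun a b i j h => by
    refine ⟨Subtype.ext (by rw [← hzℓ a i, ← hzℓ b j, h]), ?_⟩
    rcases lt_trichotomy i j with hij | hij | hij
    · exact absurd (hzlt a b i j hij) (by simp [h])
    · exact hij
    · exact absurd (hzlt b a j i hij) (by simp [h])
  -- Edges join the letters whose relative order is visible in `G`.
  let R : SimpleGraph T :=
    { Adj := fun a b => ¬ (D.Adj a b ↔ D.Adj b a)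
      symm := ⟨fun a b h h' => h h'.symm⟩
      loopless := ⟨fun a h => h Iff.rfl⟩ }
  have hzadj : ∀ a b i j, a ≠ b → (G.Adj (z a i) (z b j) ↔
      if c (z a i) < c (z b j) then D.Adj a b else D.Adj b a) := fun a b i j hab => by
    have hne : (z a i).1 ≠ (z b j).1 := fun h => hab (hzinj _ _ _ _ (Subtype.ext h)).1
    rw [hr (z a i).1, hzℓ, hzℓ]
    rcases lt_or_gt_of_ne (c.injective.ne hne) with h | h <;> simp [h, h.not_gt]
  have hzadj' : ∀ a b i j, a ≠ b → (G.Adj (z a i) (z b j) ↔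
      if c' (z a i) < c' (z b j) then D'.Adj (φ a) (φ b) else D'.Adj (φ b) (φ a)) :=
    fun a b i j hab => by
    have hne : z a i ≠ z b j := fun h => hab (hzinj _ _ _ _ h).1
    have h1 := hr' (z a i) (z b j)
    rw [hzℓ', hzℓ', SimpleGraph.comap_adj] at h1
    refine h1.trans ?_
    rcases lt_or_gt_of_ne (c'.injective.ne hne) with h | h <;> simp [h, h.not_gt]
  have horient : ∀ a b, R.Adj a b →
      (∀ i j, c' (z a i) < c' (z b j) ↔ c (z a i) < c (z b j)) ∨
      (∀ i j, c' (z a i) < c' (z b j) ↔ c (z b j) < c (z a i)) := by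
    intro a b hab
    have hne : a ≠ b := hab.ne
    have h01 : (0 : Fin (t + 1)) < Fin.last t := by simp [Fin.lt_def]; omega
    have h3 : ∀ i j, (if c (z a i) < c (z b j) then D.Adj a b else D.Adj b a) ↔
        if c' (z a i) < c' (z b j) then D'.Adj (φ a) (φ b) else D'.Adj (φ b) (φ a) :=
      fun i j => by rw [← hzadj a b i j hne, ← hzadj' a b i j hne]
    have h4 : ∀ i j, c (z b j) < c (z a i) ↔ ¬ c (z a i) < c (z b j) := fun i j => by
      have : c (z a i) ≠ c (z b j) :=
        fun h => hne (hzinj _ _ _ _ (Subtype.ext (c.injective h))).1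
      rw [not_lt, this.symm.le_iff_lt]
    rcases iff_or_iff_not_of_ite_iff_ite (P := fun i : Fin (t + 1) × Fin (t + 1) =>
      c (z a i.1) < c (z b i.2)) (P' := fun i => c' (z a i.1) < c' (z b i.2)) hab
      (i₁ := (0, Fin.last t)) (i₂ := (Fin.last t, 0)) (hzlt _ _ _ _ h01)
      (hzlt _ _ _ _ h01).not_gt fun i => h3 i.1 i.2 with h | h
    · exact Or.inl fun i j => h (i, j)
    · exact Or.inr fun i j => (h (i, j)).trans (h4 i j).symm
  obtain ⟨p, hp1, hp2, hp3, hp4⟩ := exists_common_point (R := R) (C := fun a i => c (z a i))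
    (Q := fun a i => c' (z a i)) hTcard ht' (fun a b i j h => hzinj _ _ _ _ (c'.injective h))
    hzlt fun a b hab => horient a b hab
  let r : S → T := fun s => if h : s ∈ T then ⟨s, h⟩ else Classical.arbitrary T
  have hrT : ∀ s ∈ T, (r s : S) = s := fun s hs => by simp only [r]; rw [dif_pos hs]
  refine isLetterGraph_of_reinsert hr hU hUT hUY hr' (φ ∘ r) (fun s => z (r s) 0) (fun s => z (r s) (Fin.last t))
    (p ∘ r) (fun b hb => ⟨hzU _ _, (hzℓ _ _).trans (hrT b hb), hzℓ' _ _⟩)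
    (fun b hb => ⟨hzU _ _, (hzℓ _ _).trans (hrT b hb), hzℓ' _ _⟩)
    (fun a _ b _ => hzlt _ _ _ _ (by simp [Fin.lt_def]; omega))
    (fun b _ => (hp1 _).1) (fun b _ => (hp1 _).2) (fun b _ y hy h => ?_)
    (fun a ha b hb hab => ?_) fun a _ b _ hab => hp4 _ _ hab
  · obtain ⟨a, i, hai⟩ := hp2 (r b)
    rw [Function.comp_apply, hai] at h
    exact hy (c'.injective h ▸ hzU _ _)
  · by_contra h
    refine hab (hp3 _ _ ?_)
    change ¬ (D.Adj (r a) (r b) ↔ D.Adj (r b) (r a))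
    rwa [hrT a ha, hrT b hb]

/-- A factor with at most `t` letters is shorter than `N * (m + 1)`, if `m` bounds the lengths of its
factors with at most `t - 1` letters. -/
theorem length_lt_of_le {V S : Type} {G : SimpleGraph V} {D : Digraph S} {k n t m N : ℕ}
    {ℓ : V → S} {c : V ≃ Fin n} {u : List S} (hG : IsCritical k G) (hr : IsRealisation G D ℓ c)
    (hu : u <:+: word ℓ c) (ht : {a | a ∈ u}.ncard ≤ t) (ht' : 2 ≤ t)
    (hm : ∀ v : List S, v <:+: u → {a | a ∈ v}.ncard ≤ t - 1 → v.length ≤ m)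
    (hN : (k - 1) ^ t * t + 2 ≤ N) : u.length < N * (m + 1) := by
  classical
  by_contra! hlen
  have : Finite V := Finite.of_equiv _ c.symm
  obtain ⟨off, hle, hoff⟩ := exists_offset hu
  let T := {b | b ∈ u}
  have : Finite T := u.finite_toSet
  have := Fintype.ofFinite T
  have hTcard : Nat.card T ≤ t := ht
  have hblock : ∀ (b : T) (j : Fin N), ∃ x : V, ℓ x = b ∧ off + j * (m + 1) ≤ c x ∧
      c x < off + (j + 1) * (m + 1) := fun b j =>
    exists_block hle hoff hm ht ((Nat.mul_le_mul_right _ j.2).trans hlen) b.2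
  choose x hxℓ hx1 hx2 using hblock
  have hxlt : ∀ a b i j, i < j → c (x a i) < c (x b j) := fun a b i j hij => by
    have h1 := hx2 a i
    have h2 := hx1 b j
    have h3 : (i.val + 1) * (m + 1) ≤ j * (m + 1) := Nat.mul_le_mul_right _ hij
    rw [Fin.lt_def]
    omega
  have hxinj : ∀ a b i j, x a i = x b j → a = b ∧ i = j := fun a b i j h => by
    refine ⟨Subtype.ext (by rw [← hxℓ a i, ← hxℓ b j, h]), ?_⟩
    rcases lt_trichotomy i j with hij | hij | hij
    · exact absurd (hxlt a b i j hij) (by simp [h])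
    · exact hij
    · exact absurd (hxlt b a j i hij) (by simp [h])
  set U : Set V := {y | off ≤ c y ∧ (c y : ℕ) < off + u.length} with hU
  have hxU : ∀ b j, x b j ∈ U := fun b j => by
    have h1 := hx1 b j
    have h2 := hx2 b j
    have h3 : (j.val + 1) * (m + 1) ≤ N * (m + 1) := Nat.mul_le_mul_right _ j.2
    exact ⟨by omega, by omega⟩
  have hUT : ∀ y ∈ U, ℓ y ∈ {b | b ∈ u} := by
    rintro y ⟨hy1, hy2⟩
    have h1 := hoff (c y - off) (by omega)
    have h2 : c.symm ⟨off + (c y - off), by omega⟩ = y := by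
      rw [Equiv.symm_apply_eq, Fin.ext_iff]
      simp only
      omega
    rw [h2] at h1
    exact h1 ▸ List.getElem_mem _
  have hupos : 0 < u.length := by
    have : 0 < N * (m + 1) := Nat.mul_pos (by omega) (by omega)
    omega
  have hT0 : Nonempty T := ⟨⟨u[0], List.getElem_mem _⟩⟩
  let b₀ : T := hT0.some
  let last : Fin N := ⟨N - 1, by omega⟩
  -- Omitting the last block makes `Y` proper; this accounts for one of the two extra units in `hN`,
  -- and the pigeonhole below for the other.
  let Y : Set V := Uᶜ ∪ {y | ∃ b j, j ≠ last ∧ x b j = y}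
  obtain ⟨S', _, D', m', ℓ', c', hcard, hr'⟩ := hG.exists_realisation (Y := Y) (fun h => by
    have h1 : x b₀ last ∈ Y := h ▸ Set.mem_univ _
    rcases h1 with h1 | ⟨b, j, hj, hb⟩
    · exact h1 (hxU _ _)
    · exact hj (hxinj _ _ _ _ hb).2)
  have := Fintype.ofFinite S'
  -- blocks on which the new letters agree
  let cast : Fin ((k - 1) ^ t * t + 1) → Fin N := fun i => ⟨i, by omega⟩
  have hcast : ∀ i, cast i ≠ last := fun i h => by
    have := congrArg Fin.val h
    simp only [cast, last] at this
    omega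
  let xY : T → Fin ((k - 1) ^ t * t + 1) → Y := fun b i =>
    ⟨x b (cast i), Or.inr ⟨b, _, hcast i, rfl⟩⟩
  have hS'0 : 0 < Fintype.card S' := Fintype.card_pos_iff.2 ⟨ℓ' (xY b₀ 0)⟩
  -- There are at most `(k - 1) ^ t` patterns, so more than `t` blocks share one.
  obtain ⟨φ, hφ⟩ := Fintype.exists_lt_card_fiber_of_mul_lt_card (n := t)
    (fun i (b : T) => ℓ' (xY b i)) (by
      rw [Fintype.card_fun, Fintype.card_fin]
      refine Nat.lt_succ_of_le (Nat.mul_le_mul_right _ ?_)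
      rw [Nat.card_eq_fintype_card] at hcard hTcard
      exact (Nat.pow_le_pow_right hS'0 hTcard).trans (Nat.pow_le_pow_left (by omega) _))
  let e := Finset.orderEmbOfCardLe _ hφ
  have heφ : ∀ i b, ℓ' (xY b (e i)) = φ b := fun i b => by
    have := Finset.orderEmbOfCardLe_mem _ hφ i
    exact congrFun (Finset.mem_filter.1 this).2 b
  exact hG.not_isLetterGraph hcard (isLetterGraph_of_uniform_blocks hr (isInterval_setOf _ _) hUT
    Set.subset_union_left hr' hTcard ht' (fun b i => xY b (e i)) φ (fun _ _ => hxU _ _)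
    (fun _ _ => hxℓ _ _) (fun _ _ => heφ _ _)
    (fun a b _ _ hij => hxlt a b _ _ (e.strictMono hij)))

/-! ### Bounds for `maxFactor` -/

theorem length_le_maxFactor {V S : Type} [Finite S] {G : SimpleGraph V} {D : Digraph S}
    {k n t : ℕ} {ℓ : V → S} {c : V ≃ Fin n} {u : List S} (hG : IsCritical k G)
    (hS : Nat.card S = k) (hr : IsRealisation G D ℓ c) (hu : u <:+: word ℓ c)
    (ht : {a | a ∈ u}.ncard ≤ t) : (u.length : ℕ∞) ≤ maxFactor k t :=
  le_sSup ⟨V, G, S, inferInstance, D, n, ℓ, c, u, hG, hS, hr, hu, ht, rfl⟩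

theorem maxFactor_one_le (k : ℕ) : maxFactor k 1 ≤ 3 := by
  refine sSup_le ?_
  rintro _ ⟨V, G, S, _, D, n, ℓ, c, u, hG, -, hr, hu, ht, rfl⟩
  exact_mod_cast length_le_three hG hr hu ht

theorem maxFactor_lt_mul {k t m N : ℕ} (ht : 2 ≤ t) (hm : maxFactor k (t - 1) = m)
    (hN : (k - 1) ^ t * t + 2 ≤ N) : maxFactor k t < ((N * (m + 1) : ℕ) : ℕ∞) := by
  have hpos : 0 < N * (m + 1) := Nat.mul_pos (by omega) (by omega)
  have hle : maxFactor k t ≤ ((N * (m + 1) - 1 : ℕ) : ℕ∞) := by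
    refine sSup_le ?_
    rintro _ ⟨V, G, S, _, D, n, ℓ, c, u, hG, hS, hr, hu, htu, rfl⟩
    have := length_lt_of_le (m := m) hG hr hu htu ht (fun v hv hvt => by
      have := length_le_maxFactor hG hS hr (hv.trans hu) hvt
      rw [hm] at this
      exact_mod_cast this) hN
    exact_mod_cast (by omega : u.length ≤ N * (m + 1) - 1)
  refine hle.trans_lt ?_
  exact_mod_cast (by omega : N * (m + 1) - 1 < N * (m + 1))

/-- The argument needs only the left side as number of blocks; the factor `2 ^ (t - 1) + 1` of the
theorem is slack. -/
theorem card_classes_add_two_le {k t : ℕ} (hk : 2 ≤ k) (ht : 2 ≤ t) :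
    (k - 1) ^ t * t + 2 ≤ (2 ^ (t - 1) + 1) * (k - 1) ^ t * t := by
  have h1 : 1 ≤ (k - 1) ^ t := Nat.one_le_pow _ _ (by omega)
  have h2 : 1 ≤ 2 ^ (t - 1) := Nat.one_le_two_pow
  have h3 : 2 ≤ (k - 1) ^ t * t := by nlinarith
  have h4 : (k - 1) ^ t * t ≤ 2 ^ (t - 1) * ((k - 1) ^ t * t) := Nat.le_mul_of_pos_left _ h2
  rw [mul_assoc, add_mul, one_mul]
  omega

/-- Passing from `t` to `t + 1` costs at most `k ^ (2 * t + 3)`, and these exponents sum to `t ^ 2 +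
2 * t`. The condition `t ≤ k` bounds the linear factor by `k`. -/
theorem exists_maxFactor_eq {k : ℕ} (hk : 2 ≤ k) {t : ℕ} (ht : 1 ≤ t) :
    ∃ m : ℕ, maxFactor k t = m ∧ (t ≤ k → m + 1 ≤ k ^ (t ^ 2 + 2 * t)) := by
  induction t, ht using Nat.le_induction with
  | base =>
    obtain ⟨m, hm⟩ := ENat.ne_top_iff_exists.1
      (ne_top_of_le_ne_top (ENat.natCast_ne_top 3) (maxFactor_one_le k))
    refine ⟨m, hm.symm, fun _ => ?_⟩
    have h3 : m ≤ 3 := by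
      have := maxFactor_one_le k
      rw [← hm] at this
      exact_mod_cast this
    have : 2 ^ 3 ≤ k ^ 3 := Nat.pow_le_pow_left hk 3
    norm_num
    omega
  | succ t ht ih =>
    obtain ⟨m, hm, hmk⟩ := ih
    have hlt := maxFactor_lt_mul (k := k) (t := t + 1) (m := m) (by omega) (by simpa using hm)
      (card_classes_add_two_le hk (by omega))
    obtain ⟨m', hm'⟩ := ENat.ne_top_iff_exists.1 hlt.ne_top
    refine ⟨m', hm'.symm, fun htk => ?_⟩
    rw [← hm'] at hlt
    have hlt' : m' + 1 ≤ (2 ^ (t + 1 - 1) + 1) * (k - 1) ^ (t + 1) * (t + 1) * (m + 1) := by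
      exact_mod_cast hlt
    refine hlt'.trans ?_
    have h1 : 2 ^ (t + 1 - 1) + 1 ≤ k ^ (t + 1) := by
      have h := Nat.pow_le_pow_left hk (t + 1)
      have : 1 ≤ 2 ^ t := Nat.one_le_two_pow
      rw [pow_succ] at h
      simp only [Nat.add_sub_cancel]
      omega
    have h2 : (k - 1) ^ (t + 1) ≤ k ^ (t + 1) := Nat.pow_le_pow_left (by omega) _
    calc (2 ^ (t + 1 - 1) + 1) * (k - 1) ^ (t + 1) * (t + 1) * (m + 1)
        ≤ k ^ (t + 1) * k ^ (t + 1) * k * k ^ (t ^ 2 + 2 * t) := by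
          gcongr
          exact hmk (by omega)
      _ = k ^ ((t + 1) ^ 2 + 2 * (t + 1)) := by ring

end LetterGraph

theorem mainTheorem4 :
    (∀ k : ℕ, LetterGraph.maxFactor k 1 ≤ 3) ∧
    (∀ k t : ℕ, 2 ≤ t → t ≤ k →
      LetterGraph.maxFactor k t <
        (((2 ^ (t - 1) + 1) * (k - 1) ^ t * t : ℕ) : ℕ∞) * (LetterGraph.maxFactor k (t - 1) + 1)) ∧
    (∃ C : ℝ, ∀ k : ℕ, 2 ≤ k → ∃ m : ℕ, LetterGraph.maxFactor k k = (m : ℕ∞) ∧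
      (m : ℝ) ≤ (2 : ℝ) ^ (C * (k : ℝ) ^ 2 * Real.log (k : ℝ))) := by
  -- With this `C` the bound is exactly `k ^ (2 * k ^ 2)`, as `Real.log` is natural; it suffices
  -- because `k ^ 2 + 2 * k ≤ 2 * k ^ 2`.
  refine ⟨LetterGraph.maxFactor_one_le, fun k t ht htk => ?_, 2 / Real.log 2, fun k hk => ?_⟩
  · obtain ⟨m, hm, -⟩ := LetterGraph.exists_maxFactor_eq (k := k) (t := t - 1) (by omega) (by omega)
    have := LetterGraph.maxFactor_lt_mul ht hm
      (LetterGraph.card_classes_add_two_le (by omega : 2 ≤ k) ht)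
    rw [hm]
    exact_mod_cast this
  · obtain ⟨m, hm, hmk⟩ := LetterGraph.exists_maxFactor_eq hk (t := k) (by omega)
    refine ⟨m, hm, ?_⟩
    have h1 : m ≤ k ^ (2 * k ^ 2) := by
      refine (Nat.le_succ m).trans ((hmk le_rfl).trans (Nat.pow_le_pow_right (by omega) ?_))
      nlinarith
    have hk0 : (0 : ℝ) < k := by positivity
    have h2 : (m : ℝ) ≤ (k : ℝ) ^ (2 * k ^ 2) := by exact_mod_cast h1
    refine h2.trans_eq ?_
    have hlog : Real.log 2 ≠ 0 := (Real.log_pos one_lt_two).ne'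
    rw [Real.rpow_def_of_pos two_pos, ← Real.exp_log (pow_pos hk0 (2 * k ^ 2)), Real.log_pow]
    congr 1
    push_cast
    field_simp
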